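/- Let $\mathbb D\subset\mathbb C$ be the open unit disc. For a domain $D\subset\mathbb C^n$, $z,w\in D$ and $X\in\mathbb C^n$, let $$l_D(z,w)=\inf\{|\alpha|:\alpha\in\mathbb D,\ \exists\varphi\in\mathcal O(\mathbb D,D):\varphi(0)=z,\ \varphi(\alpha)=w\}$$ be the Lempert function and $$\kappa_D(z;X)=\inf\{|\alpha|:\alpha\in\mathbb C,\ \exists\varphi\in\mathcal O(\mathbb D,D):\varphi(0)=z,\ \alpha\varphi'(0)=X\}$$ the Kobayashi–Royden pseudometric of $D$, where $\mathcal O(\mathbb D,D)$ is the set of holomorphic maps $\mathbb D\to D$. Let $\Omega_3\subset\mathcal M_3\cong\mathbb C^9$ be the spectral unit ball, i.e. the set of all complex $3\times3$ matrices all of whose eigenvalues lie in $\mathbb D$. Put $$A=\begin{pmatrix}0&0&0\\0&0&1\\0&0&0\end{pmatrix},\qquad B=\begin{pmatrix}1&0&0\\0&\omega&0\\0&0&\omega^2\end{pmatrix},\qquad \omega=e^{2\pi i/3}.$$ (a) One has $0<\kappa_{\Omega_3}(A;B)<\infty$, while $$\limsup_{\mathbb C\setminus\{0\}\ni t\to0}\frac{l_{\Omega_3}(A,A+tB)}{|t|}=0.$$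 (b) Let $(t_j)_j$ be a sequence in $\mathbb C\setminus\{0\}$ and $(C_j)_j$, $C_j=(c^j_{k,l})$, a sequence in $\mathcal M_3$ such that $t_j\to0$, $C_j\to B$ and $\liminf_{j\to\infty}|c^j_{3,2}/t_j-3|>0$ (the value $+\infty$ is allowed). Then $$\lim_{j\to\infty}\frac{l_{\Omega_3}(A,A+t_jC_j)}{|t_j|}=0.$$ -/

import Mathlib

open Filter Topology
open scoped ENNReal

section Disc

variable {E : Type*} [AddCommGroup E] [Module ℂ E] [TopologicalSpace E]

/-- `φ ∈ 𝒪(𝔻, D)`: the map `φ` is holomorphic on the open unit disc `𝔻` and maps it into `D`.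
The values of `φ` outside `𝔻` are irrelevant. -/
def IsAnalyticDisc (D : Set E) (φ : ℂ → E) : Prop :=
  DifferentiableOn ℂ φ (Metric.ball 0 1) ∧ Set.MapsTo φ (Metric.ball 0 1) D

/-- The Lempert function
`l_D(z, w) = inf {|α| : α ∈ 𝔻, ∃ φ ∈ 𝒪(𝔻, D), φ(0) = z, φ(α) = w}`,
with values in `[0, ∞]` (the infimum of the empty set is `∞`). -/
noncomputable def lempert (D : Set E) (z w : E) : ℝ≥0∞ :=
  sInf {r | ∃ α ∈ Metric.ball (0 : ℂ) 1, ∃ φ : ℂ → E,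
    IsAnalyticDisc D φ ∧ φ 0 = z ∧ φ α = w ∧ r = ‖α‖ₑ}

/-- The Kobayashi–Royden pseudometric
`κ_D(z; X) = inf {|α| : α ∈ ℂ, ∃ φ ∈ 𝒪(𝔻, D), φ(0) = z, α φ'(0) = X}`,
with values in `[0, ∞]` (the infimum of the empty set is `∞`). -/
noncomputable def kobayashiRoyden (D : Set E) (z X : E) : ℝ≥0∞ :=
  sInf {r | ∃ α : ℂ, ∃ φ : ℂ → E,
    IsAnalyticDisc D φ ∧ φ 0 = z ∧ α • deriv φ 0 = X ∧ r = ‖α‖ₑ}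

/-- The radial derivative of the Lempert function,
`limsup_{t → 0, t ≠ 0} l_D(z, z + t X) / |t|`, with complex `t`. -/
noncomputable def lempertRadialDeriv (D : Set E) (z X : E) : ℝ≥0∞ :=
  limsup (fun t : ℂ => lempert D z (z + t • X) / ‖t‖ₑ) (𝓝[≠] 0)

end Disc

/-- The spectral unit ball `Ω₃`: the complex `3 × 3` matrices all of whose eigenvalues lie in
the open unit disc. -/
def spectralBall₃ : Set (Matrix (Fin 3) (Fin 3) ℂ) :=
  {M | ∀ μ ∈ spectrum ℂ M, ‖μ‖ < 1}

/-- The primitive cube root of unity `ω = e^{2πi/3}`. -/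
noncomputable def omega₃ : ℂ := Complex.exp (2 * Real.pi * Complex.I / 3)

/-- The base point `A = E₂₃`. -/
def matA : Matrix (Fin 3) (Fin 3) ℂ := !![0, 0, 0; 0, 0, 1; 0, 0, 0]

/-- The direction `B = diag(1, ω, ω²)`. -/
noncomputable def matB : Matrix (Fin 3) (Fin 3) ℂ :=
  !![1, 0, 0; 0, omega₃, 0; 0, 0, omega₃ ^ 2]

theorem Matrix.hasDerivAt_iff_apply {m n : Type*} [Fintype m] [Fintype n]
    {φ : ℂ → Matrix m n ℂ} {φ' : Matrix m n ℂ} {z : ℂ} :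
    HasDerivAt φ φ' z ↔ ∀ i j, HasDerivAt (fun w => φ w i j) (φ' i j) z :=
  Iff.trans (hasDerivAt_pi (E' := fun _ : m => n → ℂ) (φ := φ) (φ' := φ'))
    (forall_congr' fun i => hasDerivAt_pi (φ := fun w => φ w i))

theorem Matrix.differentiableOn_iff_apply {m n : Type*} [Fintype m] [Fintype n]
    {φ : ℂ → Matrix m n ℂ} {s : Set ℂ} :
    DifferentiableOn ℂ φ s ↔ ∀ i j, DifferentiableOn ℂ (fun w => φ w i j) s :=
  Iff.trans (differentiableOn_pi (F' := fun _ : m => n → ℂ) (Φ := φ))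
    (forall_congr' fun i => differentiableOn_pi (Φ := fun w => φ w i))

theorem Matrix.hasDerivAt_deriv {m n : Type*} [Fintype m] [Fintype n]
    {φ : ℂ → Matrix m n ℂ} {z : ℂ} (h : DifferentiableAt ℂ φ z) :
    HasDerivAt φ (deriv φ z) z :=
  DifferentiableAt.hasDerivAt (F := m → n → ℂ) h

theorem Matrix.deriv_eq_of_hasDerivAt {m n : Type*} [Fintype m] [Fintype n]
    {φ : ℂ → Matrix m n ℂ} {φ' : Matrix m n ℂ} {z : ℂ} (h : HasDerivAt φ φ' z) :
    deriv φ z = φ' :=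
  HasDerivAt.deriv (F := m → n → ℂ) h

theorem Matrix.differentiableOn_mul {l m n : Type*} [Fintype l] [Fintype m] [Fintype n]
    {f : ℂ → Matrix l m ℂ} {g : ℂ → Matrix m n ℂ} {s : Set ℂ}
    (hf : DifferentiableOn ℂ f s) (hg : DifferentiableOn ℂ g s) :
    DifferentiableOn ℂ (fun z => f z * g z) s := by
  rw [Matrix.differentiableOn_iff_apply] at *
  intro i j
  simp only [Matrix.mul_apply]
  exact DifferentiableOn.fun_sum fun k _ => (hf i k).mul (hg k j)

/-- Every invertible complex matrix is the value at `1` of an entire path of invertible matrices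
that starts at the identity. -/
theorem Matrix.exists_entire_path_of_det_ne_zero {n : Type*} [Fintype n] [DecidableEq n]
    (M : Matrix n n ℂ) (hM : M.det ≠ 0) :
    ∃ P Q : ℂ → Matrix n n ℂ, DifferentiableOn ℂ P Set.univ ∧ DifferentiableOn ℂ Q Set.univ ∧
      (∀ z, P z * Q z = 1) ∧ P 0 = 1 ∧ P 1 = M := by
  refine Matrix.diagonal_transvection_induction_of_det_ne_zero (fun M => ∃ P Q : ℂ → Matrix n n ℂ,
    DifferentiableOn ℂ P Set.univ ∧ DifferentiableOn ℂ Q Set.univ ∧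
      (∀ z, P z * Q z = 1) ∧ P 0 = 1 ∧ P 1 = M) M hM (fun D hD => ?_) (fun T => ?_)
      fun A B _ _ ihA ihB => ?_
  · have hD' : ∀ i, D i ≠ 0 := by
      intro i hi
      exact hD (by rw [Matrix.det_diagonal]; exact Finset.prod_eq_zero (Finset.mem_univ i) hi)
    refine ⟨fun z => Matrix.diagonal fun i => Complex.exp (z * Complex.log (D i)),
      fun z => Matrix.diagonal fun i => Complex.exp (-(z * Complex.log (D i))), ?_, ?_, ?_, ?_, ?_⟩
    · rw [Matrix.differentiableOn_iff_apply]
      intro i j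
      by_cases h : i = j
      · subst h; simp only [Matrix.diagonal_apply_eq]; fun_prop
      · simp only [Matrix.diagonal_apply_ne _ h]; fun_prop
    · rw [Matrix.differentiableOn_iff_apply]
      intro i j
      by_cases h : i = j
      · subst h; simp only [Matrix.diagonal_apply_eq]; fun_prop
      · simp only [Matrix.diagonal_apply_ne _ h]; fun_prop
    · intro z
      simp [Matrix.diagonal_mul_diagonal, ← Complex.exp_add]
    · simp
    · simp [Complex.exp_log (hD' _)]
  · refine ⟨fun z => Matrix.transvection T.i T.j (z * T.c),
      fun z => Matrix.transvection T.i T.j (-(z * T.c)), ?_, ?_, ?_, ?_, ?_⟩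
    · rw [Matrix.differentiableOn_iff_apply]
      intro i j
      simp only [Matrix.transvection, Matrix.add_apply, Matrix.single_apply]
      split_ifs <;> fun_prop
    · rw [Matrix.differentiableOn_iff_apply]
      intro i j
      simp only [Matrix.transvection, Matrix.add_apply, Matrix.single_apply]
      split_ifs <;> fun_prop
    · intro z
      simp [Matrix.transvection_mul_transvection_same _ _ T.hij]
    · simp
    · simp [Matrix.TransvectionStruct.toMatrix]
  · obtain ⟨P, Q, hP, hQ, h, h0, h1⟩ := ihA
    obtain ⟨P', Q', hP', hQ', h', h0', h1'⟩ := ihB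
    refine ⟨fun z => P z * P' z, fun z => Q' z * Q z, Matrix.differentiableOn_mul hP hP',
      Matrix.differentiableOn_mul hQ' hQ, fun z => ?_, by simp [h0, h0'], by simp [h1, h1']⟩
    rw [Matrix.mul_assoc, ← Matrix.mul_assoc (P' z), h', Matrix.one_mul, h]

/-- The second elementary symmetric function of the eigenvalues of a `3 × 3` matrix. -/
def sigmaTwo (M : Matrix (Fin 3) (Fin 3) ℂ) : ℂ :=
  M 0 0 * M 1 1 - M 0 1 * M 1 0 + (M 0 0 * M 2 2 - M 0 2 * M 2 0) +
    (M 1 1 * M 2 2 - M 1 2 * M 2 1)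

theorem eval_charpoly_fin_three (M : Matrix (Fin 3) (Fin 3) ℂ) (x : ℂ) :
    M.charpoly.eval x = x ^ 3 - M.trace * x ^ 2 + sigmaTwo M * x - M.det := by
  rw [Matrix.eval_charpoly]
  simp [Matrix.det_fin_three, Matrix.trace_fin_three, sigmaTwo, Matrix.scalar_apply]
  ring

theorem mem_spectralBall_iff (M : Matrix (Fin 3) (Fin 3) ℂ) :
    M ∈ spectralBall₃ ↔
      ∀ x : ℂ, x ^ 3 - M.trace * x ^ 2 + sigmaTwo M * x - M.det = 0 → ‖x‖ < 1 := by
  simp only [spectralBall₃, Set.mem_ofPred_eq, Matrix.mem_spectrum_iff_isRoot_charpoly,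
    Polynomial.IsRoot.def, eval_charpoly_fin_three]

theorem norm_det_le_and_norm_sigmaTwo_le {M : Matrix (Fin 3) (Fin 3) ℂ}
    (hM : M ∈ spectralBall₃) : ‖M.det‖ ≤ 1 ∧ ‖sigmaTwo M‖ ≤ 3 := by
  have hs : M.charpoly.Splits := IsAlgClosed.splits _
  have hcard : M.charpoly.roots.card = 3 := by
    rw [← hs.natDegree_eq_card_roots, Matrix.charpoly_natDegree_eq_dim, Fintype.card_fin]
  obtain ⟨a, b, c, habc⟩ := Multiset.card_eq_three.1 hcard
  have hroot : ∀ x ∈ M.charpoly.roots, ‖x‖ ≤ 1 := fun x hx =>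
    (hM x (Matrix.mem_spectrum_iff_isRoot_charpoly.2 (Polynomial.isRoot_of_mem_roots hx))).le
  have ha : ‖a‖ ≤ 1 := hroot a (by simp [habc])
  have hb : ‖b‖ ≤ 1 := hroot b (by simp [habc])
  have hc : ‖c‖ ≤ 1 := hroot c (by simp [habc])
  have key : ∀ x : ℂ, x ^ 3 - M.trace * x ^ 2 + sigmaTwo M * x - M.det =
      (x - a) * (x - b) * (x - c) := by
    intro x
    rw [← eval_charpoly_fin_three, hs.eval_eq_prod_roots_of_monic (Matrix.charpoly_monic M), habc]
    simp [mul_assoc]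
  have h3 : M.det = a * b * c := by linear_combination -key 0
  have h2 : sigmaTwo M = a * b + a * c + b * c := by
    linear_combination (key 1 - key (-1)) / 2
  have hmul : ∀ x y : ℂ, ‖x‖ ≤ 1 → ‖y‖ ≤ 1 → ‖x * y‖ ≤ 1 := fun x y hx hy => by
    rw [norm_mul]; exact mul_le_one₀ hx (norm_nonneg _) hy
  refine ⟨h3 ▸ hmul _ _ (hmul _ _ ha hb) hc, ?_⟩
  rw [h2]
  calc _ ≤ ‖a * b‖ + ‖a * c‖ + ‖b * c‖ := norm_add₃_le
    _ ≤ 3 := by linarith [hmul a b ha hb, hmul a c ha hc, hmul b c hb hc]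

theorem norm_apply_zero_le_of_norm_pow_mul_le {F : ℂ → ℂ} {n : ℕ} {c : ℝ}
    (hF : DifferentiableOn ℂ F (Metric.ball 0 1))
    (h : ∀ z ∈ Metric.ball (0 : ℂ) 1, ‖z ^ n * F z‖ ≤ c) : ‖F 0‖ ≤ c := by
  have hr : ∀ r ∈ Set.Ioo (0 : ℝ) 1, r ^ n * ‖F 0‖ ≤ c := by
    rintro r ⟨hr0, hr1⟩
    have hsub : Metric.closedBall (0 : ℂ) r ⊆ Metric.ball 0 1 := Metric.closedBall_subset_ball hr1
    have hd : DiffContOnCl ℂ F (Metric.ball 0 r) :=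
      (hF.mono hsub).diffContOnCl_ball subset_rfl
    have := Complex.norm_le_of_forall_mem_frontier_norm_le Metric.isBounded_ball hd
      (C := c / r ^ n) (fun z hz => ?_) (subset_closure (Metric.mem_ball_self hr0))
    · rw [le_div_iff₀ (by positivity)] at this
      linarith
    · rw [frontier_ball _ hr0.ne', mem_sphere_zero_iff_norm] at hz
      have := h z (by simpa [hz] using hr1)
      rw [norm_mul, norm_pow, hz] at this
      rw [le_div_iff₀ (by positivity)]
      linarith
  have hlim : Tendsto (fun r : ℝ => r ^ n * ‖F 0‖) (𝓝[<] 1) (𝓝 (1 ^ n * ‖F 0‖)) :=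
    ((continuous_id.pow n).mul continuous_const).continuousAt.tendsto.mono_left
      nhdsWithin_le_nhds
  simpa using le_of_tendsto hlim
    (mem_of_superset (Ioo_mem_nhdsLT zero_lt_one) hr)

theorem omega_pow_three : omega₃ ^ 3 = 1 := by
  rw [omega₃, ← Complex.exp_nat_mul, ← Complex.exp_two_pi_mul_I]
  congr 1
  push_cast
  ring

theorem one_add_omega_add_sq : 1 + omega₃ + omega₃ ^ 2 = 0 := by
  have h : IsPrimitiveRoot omega₃ 3 := by
    simpa [omega₃] using Complex.isPrimitiveRoot_exp 3 (by norm_num)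
  simpa [Finset.sum_range_succ] using h.geom_sum_eq_zero (by norm_num)

/-- The quotient `(f z - f 0) / z`, extended to the origin by the derivative, is holomorphic. -/
theorem differentiableOn_dslope_zero {f : ℂ → ℂ} (hf : DifferentiableOn ℂ f (Metric.ball 0 1)) :
    DifferentiableOn ℂ (dslope f 0) (Metric.ball 0 1) :=
  (Complex.differentiableOn_dslope (Metric.ball_mem_nhds 0 one_pos)).2 hf

theorem eq_add_mul_dslope (f : ℂ → ℂ) (z : ℂ) : f z = f 0 + z * dslope f 0 z := by
  have := sub_smul_dslope f 0 z
  simp only [sub_zero, smul_eq_mul] at this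
  rw [this]; ring

theorem one_le_of_isAnalyticDisc {φ : ℂ → Matrix (Fin 3) (Fin 3) ℂ} {α : ℂ}
    (hφ : IsAnalyticDisc spectralBall₃ φ) (h0 : φ 0 = matA) (hα : α • deriv φ 0 = matB) :
    1 ≤ ‖α‖ ^ 3 + 3 * ‖α‖ ^ 2 := by
  obtain ⟨hd, hmaps⟩ := hφ
  have hα0 : α ≠ 0 := by
    rintro rfl
    have := congrFun (congrFun hα 0) 0
    simp [matB] at this
  have hderiv : HasDerivAt φ (α⁻¹ • matB) 0 := by
    have := Matrix.hasDerivAt_deriv (hd.differentiableAt (Metric.ball_mem_nhds 0 one_pos))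
    rwa [← hα, inv_smul_smul₀ hα0]
  rw [Matrix.hasDerivAt_iff_apply] at hderiv
  rw [Matrix.differentiableOn_iff_apply] at hd
  set X : Fin 3 → Fin 3 → ℂ → ℂ := fun i j => dslope (fun z => φ z i j) 0 with hX
  have hXd : ∀ i j, DifferentiableOn ℂ (X i j) (Metric.ball 0 1) := fun i j =>
    differentiableOn_dslope_zero (hd i j)
  have hX0 : ∀ i j, X i j 0 = α⁻¹ * matB i j := fun i j => by
    simp only [hX, dslope_same, (hderiv i j).deriv, Matrix.smul_apply, smul_eq_mul]
  have hφX : ∀ z i j, φ z i j = matA i j + z * X i j z := fun z i j => by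
    rw [← h0]; exact eq_add_mul_dslope (fun z => φ z i j) z
  set Y : Fin 3 → Fin 3 → ℂ → ℂ := fun i j => dslope (X i j) 0 with hY
  have hYd : ∀ i j, DifferentiableOn ℂ (Y i j) (Metric.ball 0 1) := fun i j =>
    differentiableOn_dslope_zero (hXd i j)
  have hXY : ∀ z i j, matB i j = 0 → X i j z = z * Y i j z := fun z i j hij => by
    have := eq_add_mul_dslope (X i j) z
    rwa [hX0, hij, mul_zero, zero_add] at this
  have h2 := norm_apply_zero_le_of_norm_pow_mul_le (n := 2) (c := 3) (F := fun z =>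
      X 0 0 z * X 1 1 z - X 0 1 z * X 1 0 z + (X 0 0 z * X 2 2 z - X 0 2 z * X 2 0 z) +
      (X 1 1 z * X 2 2 z - X 1 2 z * X 2 1 z) - Y 2 1 z) (by fun_prop) (fun z hz => by
    refine le_of_eq_of_le (congrArg norm ?_) (norm_det_le_and_norm_sigmaTwo_le (hmaps hz)).2
    have e := hXY z 2 1 (by simp [matB])
    simp only [sigmaTwo, hφX]
    simp [matA]
    linear_combination z * e)
  have h3 := norm_apply_zero_le_of_norm_pow_mul_le (n := 3) (c := 1) (F := fun z =>
      X 0 0 z * X 1 1 z * X 2 2 z - X 0 0 z * X 1 2 z * X 2 1 z - X 0 1 z * X 1 0 z * X 2 2 z +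
      X 0 1 z * X 1 2 z * X 2 0 z + X 0 2 z * X 1 0 z * X 2 1 z - X 0 2 z * X 1 1 z * X 2 0 z
      - X 0 0 z * Y 2 1 z + z * Y 0 1 z * Y 2 0 z) (by fun_prop) (fun z hz => by
    refine le_of_eq_of_le (congrArg norm ?_) (norm_det_le_and_norm_sigmaTwo_le (hmaps hz)).1
    have e21 := hXY z 2 1 (by simp [matB])
    have e01 := hXY z 0 1 (by simp [matB])
    have e20 := hXY z 2 0 (by simp [matB])
    simp only [Matrix.det_fin_three, hφX]
    simp [matA]
    linear_combination z ^ 2 * X 0 0 z * e21 - z ^ 2 * X 2 0 z * e01 - z ^ 3 * Y 0 1 z * e20)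
  simp only [hX0] at h2 h3
  simp [matB] at h2 h3
  have e2 : α⁻¹ * (α⁻¹ * omega₃) + α⁻¹ * (α⁻¹ * omega₃ ^ 2) +
      α⁻¹ * omega₃ * (α⁻¹ * omega₃ ^ 2) - Y 2 1 0 = -Y 2 1 0 := by
    linear_combination α⁻¹ ^ 2 * (one_add_omega_add_sq + omega_pow_three)
  have e3 : (1 : ℂ) = α ^ 3 * (α⁻¹ * (α⁻¹ * omega₃) * (α⁻¹ * omega₃ ^ 2) - α⁻¹ * Y 2 1 0)
      + α ^ 2 * Y 2 1 0 := by
    field_simp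
    linear_combination -omega_pow_three
  rw [e2, norm_neg] at h2
  calc (1 : ℝ) = ‖(1 : ℂ)‖ := by simp
    _ ≤ ‖α‖ ^ 3 * 1 + ‖α‖ ^ 2 * 3 := by
      rw [e3]
      refine (norm_add_le _ _).trans ?_
      rw [norm_mul, norm_mul, norm_pow, norm_pow]
      gcongr
    _ = _ := by ring

theorem kobayashiRoyden_matA_matB_pos : 0 < kobayashiRoyden spectralBall₃ matA matB := by
  refine lt_of_lt_of_le (b := ENNReal.ofReal (1 / 2)) (by simp) (le_sInf ?_)
  rintro r ⟨α, φ, hφ, h0, hα, rfl⟩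
  have := one_le_of_isAnalyticDisc hφ h0 hα
  rw [← ofReal_norm]
  refine ENNReal.ofReal_le_ofReal ?_
  by_contra! hlt
  have hn := norm_nonneg α
  nlinarith [mul_nonneg hn hn, mul_nonneg hn (mul_nonneg hn hn)]

theorem kobayashiRoyden_matA_matB_lt_top : kobayashiRoyden spectralBall₃ matA matB < ∞ := by
  refine lt_of_le_of_lt (sInf_le ⟨1, fun z => matA + z • matB, ⟨?_, fun z hz => ?_⟩, by simp, ?_,
    rfl⟩) (by simp)
  · rw [Matrix.differentiableOn_iff_apply]
    intro i j
    simp only [Matrix.add_apply, Matrix.smul_apply, smul_eq_mul]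
    fun_prop
  · rw [mem_spectralBall_iff]
    intro x hx
    have hx3 : x ^ 3 = z ^ 3 := by
      simp [matA, matB, Matrix.trace_fin_three, Matrix.det_fin_three, sigmaTwo] at hx
      linear_combination hx + z * (x ^ 2 - z * x) * one_add_omega_add_sq
        + (z ^ 3 - z ^ 2 * x) * omega_pow_three
    have hn : ‖x‖ ^ 3 < 1 := by
      rw [← norm_pow, hx3, norm_pow]
      exact pow_lt_one₀ (norm_nonneg _) (by simpa using hz) (by norm_num)
    exact (pow_lt_one_iff_of_nonneg (norm_nonneg _) (by norm_num)).1 hn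
  · rw [one_smul]
    refine Matrix.deriv_eq_of_hasDerivAt (Matrix.hasDerivAt_iff_apply.2 fun i j => ?_)
    simpa using ((hasDerivAt_id (0 : ℂ)).mul_const (matB i j)).const_add (matA i j)

theorem norm_lt_one_of_cubic_eq_zero {x p q r : ℂ} (hp : ‖p‖ ≤ 1 / 4) (hq : ‖q‖ ≤ 1 / 4)
    (hr : ‖r‖ ≤ 1 / 4) (h : x ^ 3 - p * x ^ 2 + q * x - r = 0) : ‖x‖ < 1 := by
  by_contra! hx
  have e : x ^ 3 = p * x ^ 2 + -(q * x) + r := by linear_combination h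
  have hn : ‖x‖ ^ 3 ≤ ‖p‖ * ‖x‖ ^ 2 + ‖q‖ * ‖x‖ + ‖r‖ := by
    rw [← norm_pow, e]
    refine norm_add₃_le.trans ?_
    simp
  have h1 : ‖p‖ * ‖x‖ ^ 2 ≤ 1 / 4 * ‖x‖ ^ 2 := by gcongr
  have h2 : ‖q‖ * ‖x‖ ≤ 1 / 4 * ‖x‖ := by gcongr
  have h3 : ‖x‖ ≤ ‖x‖ ^ 2 := by nlinarith
  have h4 : ‖x‖ ^ 2 ≤ ‖x‖ ^ 3 := by nlinarith [sq_nonneg ‖x‖]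
  linarith

/-- The matrix with rows `v`, `vN`, `vN²`. -/
def krylovMatrix (N : Matrix (Fin 3) (Fin 3) ℂ) (v : Fin 3 → ℂ) : Matrix (Fin 3) (Fin 3) ℂ :=
  Matrix.of ![v, Matrix.vecMul v N, Matrix.vecMul (Matrix.vecMul v N) N]

/-- A matrix family through `A = E₂₃` whose characteristic polynomial is
`x³ - a z x² + b z x - c z²`. -/
def companionFamily (a b c z : ℂ) : Matrix (Fin 3) (Fin 3) ℂ :=
  !![0, z, 0; 0, 0, 1; c * z, -(b * z), a * z]

theorem diagonal_mul_krylovMatrix_mul (N : Matrix (Fin 3) (Fin 3) ℂ) (v : Fin 3 → ℂ) {α : ℂ}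
    (hα : α ≠ 0) :
    Matrix.diagonal ![α, 1, 1] * krylovMatrix N v * N =
      companionFamily (N.trace / α) (sigmaTwo N / α) (N.det / α ^ 2) α *
        (Matrix.diagonal ![α, 1, 1] * krylovMatrix N v) := by
  have ha : N.trace / α * α = N.trace := by field_simp
  have hb : sigmaTwo N / α * α = sigmaTwo N := by field_simp
  have hc : N.det / α ^ 2 * α * α = N.det := by field_simp
  ext i j
  fin_cases i
  · fin_cases j <;>
      simp [Matrix.mul_apply, Fin.sum_univ_three, krylovMatrix, companionFamily, Matrix.vecMul,
        dotProduct, Matrix.diagonal] <;> ring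
  · fin_cases j <;>
      simp [Matrix.mul_apply, Fin.sum_univ_three, krylovMatrix, companionFamily, Matrix.vecMul,
        dotProduct, Matrix.diagonal] <;> ring
  · fin_cases j <;>
      simp [Matrix.mul_apply, Fin.sum_univ_three, krylovMatrix, companionFamily, Matrix.vecMul,
        dotProduct, Matrix.diagonal, ha, hb, ← mul_assoc, hc] <;>
      simp only [Matrix.det_fin_three, Matrix.trace_fin_three, sigmaTwo] <;> ring

theorem lempert_matA_le {N : Matrix (Fin 3) (Fin 3) ℂ} {v : Fin 3 → ℂ} {α : ℂ}
    (hα0 : α ≠ 0) (hα1 : ‖α‖ < 1) (hv : (krylovMatrix N v).det ≠ 0)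
    (h1 : ‖N.trace / α‖ ≤ 1 / 4) (h2 : ‖sigmaTwo N / α‖ ≤ 1 / 4)
    (h3 : ‖N.det / α ^ 2‖ ≤ 1 / 4) : lempert spectralBall₃ matA N ≤ ‖α‖ₑ := by
  set T := Matrix.diagonal ![α, 1, 1] * krylovMatrix N v with hT
  have hTdet : T.det ≠ 0 := by
    rw [hT, Matrix.det_mul, Matrix.det_diagonal]
    simp [Fin.prod_univ_three, hα0, hv]
  obtain ⟨P, Q, hP, hQ, hPQ, hP0, hP1⟩ := T.exists_entire_path_of_det_ne_zero hTdet
  have hQP : ∀ z, Q z * P z = 1 := fun z => mul_eq_one_comm.1 (hPQ z)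
  set a := N.trace / α
  set b := sigmaTwo N / α
  set c := N.det / α ^ 2
  have hmem : ∀ z : ℂ, z / α ∈ Set.univ := fun _ => Set.mem_univ _
  have hdiv : DifferentiableOn ℂ (fun z : ℂ => z / α) (Metric.ball 0 1) := by fun_prop
  have hcomp : ∀ {R : ℂ → Matrix (Fin 3) (Fin 3) ℂ}, DifferentiableOn ℂ R Set.univ →
      DifferentiableOn ℂ (fun z => R (z / α)) (Metric.ball 0 1) := by
    intro R hR
    rw [Matrix.differentiableOn_iff_apply] at hR ⊢
    exact fun i j => (hR i j).comp hdiv fun z _ => hmem z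
  refine sInf_le ⟨α, by simpa using hα1,
    fun z => Q (z / α) * companionFamily a b c z * P (z / α), ⟨?_, fun z hz => ?_⟩, ?_, ?_, rfl⟩
  · refine Matrix.differentiableOn_mul (Matrix.differentiableOn_mul (hcomp hQ) ?_) (hcomp hP)
    rw [Matrix.differentiableOn_iff_apply]
    intro i j
    fin_cases i <;> fin_cases j <;> simp [companionFamily] <;> fun_prop
  · have hz1 : ‖z‖ ≤ 1 := by simpa using (Metric.ball_subset_closedBall hz)
    have hle : ∀ {s y : ℂ}, ‖s‖ ≤ 1 / 4 → ‖y‖ ≤ 1 → ‖s * y‖ ≤ 1 / 4 := fun hs hy => by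
      rw [norm_mul]; exact (mul_le_of_le_one_right (norm_nonneg _) hy).trans hs
    intro x hx
    rw [Matrix.mem_spectrum_iff_isRoot_charpoly, Matrix.charpoly_mul_comm, ← Matrix.mul_assoc, hPQ,
      Matrix.one_mul, Polynomial.IsRoot.def, eval_charpoly_fin_three] at hx
    refine norm_lt_one_of_cubic_eq_zero (hle h1 hz1) (hle h2 hz1)
      (hle h3 (y := z ^ 2) (by rw [norm_pow]; exact pow_le_one₀ (norm_nonneg _) hz1)) (x := x) ?_
    simp [companionFamily, Matrix.trace_fin_three, Matrix.det_fin_three, sigmaTwo] at hx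
    linear_combination hx
  · have hQ0 : Q 0 = 1 := by simpa [hP0] using hPQ 0
    simp [hP0, hQ0, companionFamily, matA]
  · simp only [div_self hα0]
    rw [Matrix.mul_assoc, hP1, ← diagonal_mul_krylovMatrix_mul N v hα0, ← hT, ← hP1,
      ← Matrix.mul_assoc, hQP, Matrix.one_mul]

/-- The quadratic part of `det (krylovMatrix (A + tC) (y, 1, 0)) / t`. -/
def krylovQuadratic (y t : ℂ) (C : Matrix (Fin 3) (Fin 3) ℂ) : ℂ :=
  let p := y * C 0 0 + C 1 0
  let q := y * C 0 1 + C 1 1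
  let r := 1 + t * C 1 2 + y * t * C 0 2
  let s := t * (p * C 0 2 + q * C 1 2) + q + r * C 2 2
  y * (q * s - r * (p * C 0 1 + q * C 1 1)) - (p * s - r * (p * C 0 0 + q * C 1 0))

theorem det_krylovMatrix_sub (t : ℂ) (C : Matrix (Fin 3) (Fin 3) ℂ) :
    (krylovMatrix (matA + t • C) ![1, 1, 0]).det - (krylovMatrix (matA + t • C) ![-1, 1, 0]).det =
      t * (t * (krylovQuadratic 1 t C - krylovQuadratic (-1) t C +
          4 * (1 + t * C 1 2) * C 0 2 * C 2 0) -
        ((1 + t * C 1 2 + t * C 0 2) ^ 2 + (1 + t * C 1 2 - t * C 0 2) ^ 2) * C 2 1) := by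
  simp [krylovMatrix, krylovQuadratic, Matrix.det_fin_three, Matrix.vecMul, dotProduct,
    Fin.sum_univ_three, matA, Matrix.mul_apply]
  ring

theorem tendsto_lempert_div {ι : Type*} {l : Filter ι} {t : ι → ℂ}
    {C : ι → Matrix (Fin 3) (Fin 3) ℂ} (ht0 : ∀ᶠ j in l, t j ≠ 0) (ht : Tendsto t l (𝓝 0))
    (hC : Tendsto C l (𝓝 matB)) {δ : ℝ} (hδ : 0 < δ)
    (hsep : ∀ᶠ j in l, δ < ‖C j 2 1 / t j - 3‖) :
    Tendsto (fun j => lempert spectralBall₃ matA (matA + t j • C j) / ‖t j‖ₑ) l (𝓝 0) := by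
  have hpair : Tendsto (fun j => (t j, C j)) l (𝓝 (0, matB)) := ht.prodMk_nhds hC
  have hlim : ∀ {f : ℂ × Matrix (Fin 3) (Fin 3) ℂ → ℂ}, Continuous f →
      Tendsto (fun j => f (t j, C j)) l (𝓝 (f (0, matB))) := fun hf => (hf.tendsto _).comp hpair
  have hω := one_add_omega_add_sq
  have hω3 := omega_pow_three
  have hg := hlim (f := fun x => krylovQuadratic 1 x.1 x.2 - krylovQuadratic (-1) x.1 x.2 +
    4 * (1 + x.1 * x.2 1 2) * x.2 0 2 * x.2 2 0) (by unfold krylovQuadratic; fun_prop)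
  have hh := hlim (f := fun x => (1 + x.1 * x.2 1 2 + x.1 * x.2 0 2) ^ 2 +
    (1 + x.1 * x.2 1 2 - x.1 * x.2 0 2) ^ 2) (by fun_prop)
  have hs1 := hlim (f := fun x => x.2 0 0 + x.2 1 1 + x.2 2 2) (by fun_prop)
  have hs2 := hlim (f := fun x => x.1 * sigmaTwo x.2 - x.2 2 1) (by unfold sigmaTwo; fun_prop)
  have hs3 := hlim (f := fun x => x.1 * x.2.det - (x.2 0 0 * x.2 2 1 - x.2 0 1 * x.2 2 0))
    (by simp only [Matrix.det_fin_three]; fun_prop)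
  have eg : krylovQuadratic 1 0 matB - krylovQuadratic (-1) 0 matB +
      4 * (1 + 0 * matB 1 2) * matB 0 2 * matB 2 0 = 6 := by
    simp [krylovQuadratic, matB]
    linear_combination (-2) * hω + 2 * hω3
  have eh : (1 + 0 * matB 1 2 + 0 * matB 0 2) ^ 2 + (1 + 0 * matB 1 2 - 0 * matB 0 2) ^ 2 =
    (2 : ℂ) := by norm_num
  have e1 : matB 0 0 + matB 1 1 + matB 2 2 = 0 := by simpa [matB] using hω
  have e2 : 0 * sigmaTwo matB - matB 2 1 = 0 := by simp [matB]
  have e3 : 0 * matB.det - (matB 0 0 * matB 2 1 - matB 0 1 * matB 2 0) = 0 := by simp [matB]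
  dsimp only at hg hh hs1 hs2 hs3
  rw [eg] at hg
  rw [eh] at hh
  rw [e1] at hs1
  rw [e2] at hs2
  rw [e3] at hs3
  have hquot := hg.div hh two_ne_zero
  rw [show (6 : ℂ) / 2 = 3 by norm_num] at hquot
  rw [ENNReal.tendsto_nhds_zero]
  intro ε hε
  obtain ⟨e, he0, he1, heε⟩ : ∃ e : ℝ, 0 < e ∧ e < 1 ∧ ENNReal.ofReal e ≤ ε := by
    obtain ⟨r, hr0, hr⟩ := ENNReal.lt_iff_exists_real_btwn.1 (lt_min hε one_pos)
    have h0 : 0 < r := ENNReal.ofReal_pos.1 hr.1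
    refine ⟨r, h0, ?_, (hr.2.trans_le (min_le_left _ _)).le⟩
    have := hr.2.trans_le (min_le_right _ _)
    rwa [ENNReal.ofReal_lt_one] at this
  have he : (e : ℂ) ≠ 0 := by exact_mod_cast he0.ne'
  have small : ∀ {f : ι → ℂ} (d : ℂ), Tendsto f l (𝓝 0) → ∀ᶠ j in l, ‖f j / d‖ ≤ 1 / 4 := by
    intro f d hf
    have h := (hf.div_const d).norm
    rw [zero_div, norm_zero] at h
    exact h.eventually_le_const (by norm_num)
  have hclose := Metric.tendsto_nhds.1 hquot δ hδ
  have ht1 := Metric.tendsto_nhds.1 ht 1 one_pos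
  filter_upwards [ht0, hsep, hclose, hh.eventually_ne two_ne_zero, ht1, small e hs1, small e hs2,
    small (e ^ 2) hs3] with j ht0 hsep hclose hh ht1 hs1 hs2 hs3
  have hne : (krylovMatrix (matA + t j • C j) ![1, 1, 0]).det -
      (krylovMatrix (matA + t j • C j) ![-1, 1, 0]).det ≠ 0 := by
    rw [det_krylovMatrix_sub]
    refine mul_ne_zero ht0 fun h0 => ?_
    rw [dist_eq_norm] at hclose
    refine lt_asymm hsep (lt_of_eq_of_lt (congrArg (fun x : ℂ => ‖x - 3‖) ?_) hclose)
    simp only [Pi.div_apply]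
    rw [div_eq_div_iff ht0 hh]
    linear_combination -h0
  obtain ⟨v, hv⟩ : ∃ v, (krylovMatrix (matA + t j • C j) v).det ≠ 0 := by
    by_contra! h
    exact hne (by rw [h, h, sub_zero])
  have hle := lempert_matA_le (α := e * t j) (mul_ne_zero he ht0) ?_ hv ?_ ?_ ?_
  · refine le_trans ?_ heε
    refine ENNReal.div_le_of_le_mul (hle.trans_eq ?_)
    rw [enorm_mul, ← ofReal_norm (e : ℂ), Complex.norm_real, Real.norm_of_nonneg he0.le]
  · rw [norm_mul, Complex.norm_real, Real.norm_of_nonneg he0.le]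
    rw [dist_zero_right] at ht1
    exact mul_lt_one_of_nonneg_of_lt_one_left he0.le he1 ht1.le
  · convert hs1 using 2
    rw [div_eq_div_iff (mul_ne_zero he ht0) he]
    simp [matA, Matrix.trace_fin_three]
    ring
  · convert hs2 using 2
    rw [div_eq_div_iff (mul_ne_zero he ht0) he]
    simp [matA, sigmaTwo]
    ring
  · convert hs3 using 2
    rw [div_eq_div_iff (pow_ne_zero _ (mul_ne_zero he ht0)) (pow_ne_zero _ he)]
    simp [matA, Matrix.det_fin_three]
    ring

theorem lempertRadialDeriv_matA_matB : lempertRadialDeriv spectralBall₃ matA matB = 0 := by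
  refine Tendsto.limsup_eq (tendsto_lempert_div (δ := 1) eventually_mem_nhdsWithin
    (tendsto_id.mono_left nhdsWithin_le_nhds) tendsto_const_nhds one_pos (.of_forall fun t => ?_))
  simp [matB]

theorem proposition1 :
    -- (a), including that the infimum defining the pseudometric is a finite number
    (0 < kobayashiRoyden spectralBall₃ matA matB ∧
      kobayashiRoyden spectralBall₃ matA matB < ∞ ∧
      lempertRadialDeriv spectralBall₃ matA matB = 0) ∧
    -- (b); the entry in row 3, column 2 is `C j 2 1`
    (∀ (t : ℕ → ℂ) (C : ℕ → Matrix (Fin 3) (Fin 3) ℂ),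
      (∀ j, t j ≠ 0) → Tendsto t atTop (𝓝 0) → Tendsto C atTop (𝓝 matB) →
      0 < liminf (fun j => ‖C j 2 1 / t j - 3‖ₑ) atTop →
      Tendsto (fun j => lempert spectralBall₃ matA (matA + t j • C j) / ‖t j‖ₑ)
        atTop (𝓝 0)) := by
  refine ⟨⟨kobayashiRoyden_matA_matB_pos, kobayashiRoyden_matA_matB_lt_top,
    lempertRadialDeriv_matA_matB⟩, fun t C ht0 ht hC hlim => ?_⟩
  obtain ⟨δ, -, hδ, hδlim⟩ := ENNReal.lt_iff_exists_real_btwn.1 hlim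
  refine tendsto_lempert_div (.of_forall ht0) ht hC (ENNReal.ofReal_pos.1 hδ)
    ((eventually_lt_of_lt_liminf hδlim).mono fun j hj => ?_)
  rw [← ofReal_norm] at hj
  exact (ENNReal.ofReal_lt_ofReal_iff'.1 hj).1
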